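/- **Setting.** Let $\mathbb T=\bigcup_{n\in\mathbb N}\mathbb R^n$ be the set of traces and let $w:\mathbb T\to\mathbb R_{\ge 0}$ be tree-representable: if $w(q)>0$ then $w(q^{1\dots k})=0$ for every $k<|q|$. Put $w_{\le n}(q)=\sum_{k=1}^n w(q^{1\dots k})$ and let $U_n=-\log w_{\le n}$ be the partial function on $\mathbb R^n$ with domain $\{w_{\le n}>0\}$. Let $q_0\in\mathbb T$ with $w(q_0)>0$, step size $\epsilon\in\mathbb R$, and $L,M\in\mathbb N$. Write $\mathrm{supported}(q)$ for $q^{1\dots k}$ with the least $k\ge 1$ such that $w(q^{1\dots k})\ne 0$ or $k\ge|q|$. Programs may draw from the standard normal distribution ($\mathsf{normal}$), score, branch and loop. Using an undefined gradient (the gradient of $U_n$ at $q$ is defined iff $U_n$ is defined near $q$ and differentiable at $q$) or dividing by zero makes an execution fail. **Equivalence.** Programs are run from weight $1$ and the empty trace; each draw is appended to the trace, scoring multiplies the weight, and weights do not include Gaussian densities. The value function of a program maps a trace $t$ to the value returned when the program terminates with trace exactly $t$, and to $\bot$ if there is no such execution; the weight function maps $t$ to the final weight of that execution, and to $0$ if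 there is none. Two programs are equivalent if they have the same value function and the same weight function. **Leapfrog step** at $(q,p)$ with potential $U$: $p\leftarrow p-\frac\epsilon2\nabla U(q)$; $q\leftarrow q+\epsilon p$; $p\leftarrow p-\frac\epsilon2\nabla U(q)$. **NPHMC$(q_0,w,\epsilon,L,M)$** returns the list $[S_0,\dots,S_M]$ with $S_0=q_0$, where $S_{j+1}$ is computed from $S_j$ as follows. Set $q_0:=S_j$, draw the $|q_0|$ components of $p_0$ from $\mathsf{normal}$, set $(q,p)=(q_0,p_0)$, and for $i=0,\dots,L-1$ do: (a) $p\leftarrow p-\frac\epsilon2\nabla U_{|q_0|}(q)$, $q\leftarrow q+\epsilon p$; (b) with $t=(i+1)\epsilon$ the elapsed time, while $q\notin\mathrm{dom}\,U_{|q|}$ draw $x_0$, then $y_0$, from $\mathsf{normal}$ and append $x_0,y_0,x_0+ty_0,y_0$ to $q_0,p_0,q,p$ respectively; (c) $p\leftarrow p-\frac\epsilon2\nabla U_{|q_0|}(q)$. Finally draw $z$ from $\mathsf{normal}$ and let $S_{j+1}=\mathrm{supported}(q)$ if $\Phi(z)<\alpha$, and $S_{j+1}=\mathrm{supported}(q_0)$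 otherwise. Here $\Phi$ is the standard normal cdf and $\alpha=\min\{1,\frac{w_{\le N}(q)\,\varphi_{2N}(q,p)}{w_{\le N}(q_0)\,\varphi_{2N}(q_0,p_0)}\}$, with $N=|q|$ and $\varphi_{2N}$ the $2N$-dimensional standard normal density. **eNPHMC$(q_0,w,\epsilon,L,M)$** computes states $s_0=(q_0,0),s_1,\dots,s_M$ and returns the list of $\mathrm{supported}(\text{position of }s_j)$, $j=0,\dots,M$. The state $s_{j+1}$ is computed from $s_j$ as follows. Let $q_0$ be $\mathrm{supported}$ of the position of $s_j$, and draw the $|q_0|$ components of $p_0$ from $\mathsf{normal}$. While the state is not valid, draw $x_0$, then $y_0$, from $\mathsf{normal}$ and append them to $q_0,p_0$. Validity is tested by performing $L$ leapfrog steps from $(q_0,p_0)$ with the fixed potential $U_{|q_0|}$; the test stops with "not valid" as soon as a position step leaves $\mathrm{dom}\,U_{|q_0|}$. Then perform $L$ leapfrog steps with $U_{|q_0|}$ from $(q_0,p_0)$ and flip the momentum to get $(q,p)$. Draw $z$ from $\mathsf{normal}$ and let $s_{j+1}=(q,p)$ if $\Phi(z)<\alpha$, and $s_{j+1}=(q_0,p_0)$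 otherwise, with $\alpha$ as above. **Claim.** For all such $w,q_0,\epsilon,L,M$, the programs NPHMC$(q_0,w,\epsilon,L,M)$ and eNPHMC$(q_0,w,\epsilon,L,M)$ are equivalent, i.e. they induce the same value function and the same weight function on traces. -/

import Mathlib

open scoped NNReal Topology

noncomputable section

/-- Traces: finite sequences of reals, i.e. elements of the disjoint union of all `ℝ^n`. -/
abbrev Trace := List ℝ

/-- States: a position together with a momentum. -/
abbrev State := List ℝ × List ℝ

/-! ### The probabilistic language and its operational semantics -/

/-- Call-by-value probabilistic programs with result in `α`: sampling from the standard normal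
distribution, scoring, failure (a primitive applied outside its domain), sequencing, and unbounded
loops. Pure computations on reals, lists and pairs are written in the host language. -/
inductive Prog : Type → Type 1
  | ret {α : Type} (a : α) : Prog α
  | bind {α β : Type} (m : Prog α) (k : α → Prog β) : Prog β
  | normal : Prog ℝ
  | score (r : ℝ) : Prog ℝ
  | fail {α : Type} : Prog α
  | whileLoop {σ : Type} (cond : σ → Prog Bool) (body : σ → Prog σ) (s : σ) : Prog σ

instance : Monad Prog where
  pure := Prog.ret
  bind := Prog.bind

/-- Configurations: a program with the current weight and the trace of samples drawn so far, or
the failure configuration. -/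
inductive Config (α : Type) : Type 1
  | run (m : Prog α) (wt : ℝ≥0) (t : Trace) : Config α
  | fail : Config α

/-- Small-step reduction of configurations. -/
inductive Step : {α : Type} → Config α → Config α → Prop
  | bind_ret {α β : Type} (a : α) (k : α → Prog β) (wt : ℝ≥0) (t : Trace) :
      Step (.run (.bind (.ret a) k) wt t) (.run (k a) wt t)
  | bind_run {α β : Type} {m m' : Prog α} (k : α → Prog β) {wt wt' : ℝ≥0} {t t' : Trace} :
      Step (.run m wt t) (.run m' wt' t') →
      Step (.run (.bind m k) wt t) (.run (.bind m' k) wt' t')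
  | bind_fail {α β : Type} {m : Prog α} (k : α → Prog β) {wt : ℝ≥0} {t : Trace} :
      Step (.run m wt t) .fail → Step (.run (.bind m k) wt t) .fail
  | normal (r : ℝ) (wt : ℝ≥0) (t : Trace) :
      Step (.run .normal wt t) (.run (.ret r) wt (t ++ [r]))
  | score_pos {r : ℝ} (hr : 0 < r) (wt : ℝ≥0) (t : Trace) :
      Step (.run (.score r) wt t) (.run (.ret r) (⟨r, hr.le⟩ * wt) t)
  | score_nonpos {r : ℝ} (hr : r ≤ 0) (wt : ℝ≥0) (t : Trace) :
      Step (.run (.score r) wt t) .fail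
  | fail {α : Type} (wt : ℝ≥0) (t : Trace) :
      Step (.run (.fail : Prog α) wt t) .fail
  | whileLoop {σ : Type} (cond : σ → Prog Bool) (body : σ → Prog σ) (s : σ)
      (wt : ℝ≥0) (t : Trace) :
      Step (.run (.whileLoop cond body s) wt t)
        (.run (.bind (cond s) fun b =>
          if b then .bind (body s) (.whileLoop cond body) else .ret s) wt t)

/-- `⟨m, 1, []⟩` reduces in finitely many steps to the value `v` with weight `wt` and trace `t`. -/
def Evaluates {α : Type} (m : Prog α) (v : α) (wt : ℝ≥0) (t : Trace) : Prop :=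
  Relation.ReflTransGen Step (Config.run m 1 []) (Config.run (.ret v) wt t)

open scoped Classical in
/-- The value function of a program; `none` stands for `⊥`. Reduction is deterministic once the
trace is fixed, so there is at most one value. -/
def valueFn {α : Type} (m : Prog α) (t : Trace) : Option α :=
  if h : ∃ v, ∃ wt, Evaluates m v wt t then some h.choose else none

open scoped Classical in
/-- The weight function of a program; it is `0` on the traces on which the program does not
terminate in a value. -/
def weightFn {α : Type} (m : Prog α) (t : Trace) : ℝ≥0 :=
  if h : ∃ wt, ∃ v, Evaluates m v wt t then h.choose else 0

/-- Two programs are equivalent if they induce the same value and weight functions. -/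
def Equivalent {α : Type} (m m' : Prog α) : Prop :=
  valueFn m = valueFn m' ∧ weightFn m = weightFn m'

/-! ### Control flow -/

/-- `for i in range(n): s = body(i, s)`, returning the final `s`. -/
def forRange {σ : Type} : (n : ℕ) → (body : ℕ → σ → Prog σ) → σ → Prog σ
  | 0, _, s => pure s
  | n + 1, body, s => do
      let s' ← forRange n body s
      body n s'

/-- `[normal for i in range(n)]` -/
def normals : ℕ → Prog (List ℝ)
  | 0 => pure []
  | n + 1 => do
      let xs ← normals n
      let x ← Prog.normal
      pure (xs ++ [x])

/-- Use an optional value; `None` makes the program fail. -/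
def orFail {α : Type} : Option α → Prog α
  | some a => pure a
  | none => Prog.fail

/-! ### Densities, potential energy, gradients -/

/-- Tree representability (prefix property): if `q` has positive weight, then every proper prefix
of `q` has weight zero. -/
def TreeRepresentable (w : Trace → ℝ≥0) : Prop :=
  ∀ q : Trace, 0 < w q → ∀ k < q.length, w (q.take k) = 0

/-- The truncation `w_{≤ n}(q) = ∑_{k=1}^n w(q^{1…k})`. -/
def trunc (w : Trace → ℝ≥0) (n : ℕ) (q : Trace) : ℝ :=
  ∑ k ∈ Finset.Icc 1 n, (w (q.take k) : ℝ)

/-- The potential energy `U_n = -log w_{≤ n}`, a partial function on `ℝ^n` with domain the set of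
points where `w_{≤ n}` is positive. -/
def potential (w : Trace → ℝ≥0) (n : ℕ) : Trace →. ℝ := fun q =>
  ⟨q.length = n ∧ 0 < trunc w n q, fun _ => -Real.log (trunc w n q)⟩

open scoped Classical in
/-- The restriction to `ℝ^n` of a partial function on traces, extended by `0` off its domain. -/
def restrict (f : Trace →. ℝ) (n : ℕ) (x : Fin n → ℝ) : ℝ :=
  if h : (f (List.ofFn x)).Dom then (f (List.ofFn x)).get h else 0

/-- The partial function `f` is defined near `q` (in `ℝ^n`, `n` the length of `q`) and is
differentiable at `q`. -/
def GradDefined (f : Trace →. ℝ) (q : Trace) : Prop :=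
  (∀ᶠ x in 𝓝 (q.get : Fin q.length → ℝ), List.ofFn x ∈ f.Dom) ∧
    DifferentiableAt ℝ (restrict f q.length) q.get

open scoped Classical in
/-- The gradient of the partial function `f` at `q` (the vector of partial derivatives) if it is
defined, and `none` if not. -/
def grad (f : Trace →. ℝ) (q : Trace) : Option (List ℝ) :=
  if GradDefined f q then
    some (List.ofFn fun i => fderiv ℝ (restrict f q.length) q.get (Pi.single i 1))
  else none

/-- Density of the standard normal distribution in dimension `x.length` at `x`. -/
def pdfN (x : List ℝ) : ℝ := (x.map (ProbabilityTheory.gaussianPDFReal 0 1)).prod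

/-- Cumulative distribution function of the standard normal distribution. -/
def cdfN (x : ℝ) : ℝ := ProbabilityTheory.cdf (ProbabilityTheory.gaussianReal 0 1) x

/-! ### Helper programs -/

/-- `x + c * y` for vectors `x`, `y` of the same length. -/
def axpy (x : List ℝ) (c : ℝ) (y : List ℝ) : List ℝ := List.zipWith (fun a b => a + c * b) x y

/-- Half momentum step `p - ep/2 * grad(f, q)`; fails if the gradient is not defined. -/
def halfKick (f : Trace →. ℝ) (ep : ℝ) (q p : List ℝ) : Prog (List ℝ) := do
  let g ← orFail (grad f q)
  pure (axpy p (-(ep / 2)) g)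

/-- The Metropolis-Hastings acceptance ratio; division by zero fails. -/
def accept (s s₀ : State) (w : Trace → ℝ≥0) : Prog ℝ :=
  let N := s.1.length
  let num := trunc w N s.1 * pdfN (s.1 ++ s.2)
  let den := trunc w N s₀.1 * pdfN (s₀.1 ++ s₀.2)
  if den = 0 then Prog.fail else pure (min 1 (num / den))

open scoped Classical in
/-- The loop `while w(q[:k]) == 0 and k < len(q): k += 1`, returning `q[:k]`. -/
def supportedFrom (q : Trace) (w : Trace → ℝ≥0) (k : ℕ) : Trace :=
  if w (q.take k) = 0 ∧ k < q.length then supportedFrom q w (k + 1) else q.take k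
termination_by q.length - k

/-- The `w`-supported prefix of `q`. -/
def supported (q : Trace) (w : Trace → ℝ≥0) : Trace := supportedFrom q w 1

/-! ### The program NPHMC -/

open scoped Classical in
/-- While `q` is outside the domain of `U(len(q))`, increment the dimension of the current state
and of the initial state; `t` is the time elapsed since the initial state. -/
def extend (s : State × State) (t : ℝ) (U : ℕ → Trace →. ℝ) : Prog (State × State) :=
  Prog.whileLoop
    (fun s => pure (decide (s.1.1 ∉ (U s.1.1.length).Dom)))
    (fun s => do
      let ((q, p), (q₀, p₀)) := s
      let x₀ ← Prog.normal
      let y₀ ← Prog.normal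
      pure ((q ++ [x₀ + t * y₀], p ++ [y₀]), (q₀ ++ [x₀], p₀ ++ [y₀])))
    s

/-- Integration with dynamic dimension. When `extend` is called in iteration `i = 0, …, L - 1`,
exactly `i + 1` position steps of size `ep` have been performed. -/
def NPint (s₀ : State) (U : ℕ → Trace →. ℝ) (ep : ℝ) (L : ℕ) : Prog (State × State) :=
  forRange L
    (fun i s => do
      let ((q, p), (q₀, p₀)) := s
      let p ← halfKick (U q₀.length) ep q p
      let q := axpy q ep p
      let ((q, p), (q₀, p₀)) ← extend ((q, p), (q₀, p₀)) (((i : ℝ) + 1) * ep) U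
      let p ← halfKick (U q₀.length) ep q p
      pure ((q, p), (q₀, p₀)))
    (s₀, s₀)

def NPHMCstep (q₀ : Trace) (w : Trace → ℝ≥0) (ep : ℝ) (L : ℕ) : Prog Trace := do
  let p₀ ← normals q₀.length
  let U := potential w
  let ((q, p), (q₀, p₀)) ← NPint (q₀, p₀) U ep L
  let z ← Prog.normal
  let a ← accept (q, p) (q₀, p₀) w
  if cdfN z < a then pure (supported q w) else pure (supported q₀ w)

/-- The chain of samples `[S[0], …, S[M]]` with `S[0] = q₀`. -/
def NPHMC (q₀ : Trace) (w : Trace → ℝ≥0) (ep : ℝ) (L M : ℕ) : Prog (List Trace) :=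
  forRange M
    (fun i S => do
      let q ← NPHMCstep (S.getD i []) w ep L
      pure (S ++ [q]))
    [q₀]

/-! ### The program eNPHMC -/

open scoped Classical in
/-- Do `L` leapfrog steps from the given state stay in the domain of `U`? Fails if a gradient that
is needed is not defined. -/
def validstate (s₀ : State) (U : Trace →. ℝ) (ep : ℝ) : (L : ℕ) → Prog Bool
  | 0 => pure true
  | L + 1 => do
      let (q, p) := s₀
      let p ← halfKick U ep q p
      let q := axpy q ep p
      if q ∉ U.Dom then pure false
      else do
        let p ← halfKick U ep q p
        validstate (q, p) U ep L

/-- The leapfrog integrator of fixed-dimension HMC, with momentum flip at the end. -/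
def HMCint (s₀ : State) (U : Trace →. ℝ) (ep : ℝ) (L : ℕ) : Prog State := do
  let (q, p) ← forRange L
    (fun _ s => do
      let (q, p) := s
      let p ← halfKick U ep q p
      let q := axpy q ep p
      let p ← halfKick U ep q p
      pure (q, p))
    s₀
  pure (q, p.map fun a => -a)

/-- While the state is not valid in its own dimension, increment its dimension. -/
def search (s₀ : State) (U : ℕ → Trace →. ℝ) (ep : ℝ) (L : ℕ) : Prog State :=
  Prog.whileLoop
    (fun s => do
      let b ← validstate s (U s.1.length) ep L
      pure (!b))
    (fun s => do
      let (q₀, p₀) := s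
      let x₀ ← Prog.normal
      let y₀ ← Prog.normal
      pure (q₀ ++ [x₀], p₀ ++ [y₀]))
    s₀

def eNPHMCstep (s₀ : State) (w : Trace → ℝ≥0) (ep : ℝ) (L : ℕ) : Prog State := do
  let q₀ := supported s₀.1 w
  let p₀ ← normals q₀.length
  let U := potential w
  let (q₀, p₀) ← search (q₀, p₀) U ep L
  let (q, p) ← HMCint (q₀, p₀) (U q₀.length) ep L
  let z ← Prog.normal
  let a ← accept (q, p) (q₀, p₀) w
  if cdfN z < a then pure (q, p) else pure (q₀, p₀)

/-- The chain of states, marginalised at the end to a chain of samples. -/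
def eNPHMC (q₀ : Trace) (w : Trace → ℝ≥0) (ep : ℝ) (L M : ℕ) : Prog (List Trace) := do
  let mc ← forRange M
    (fun i mc => do
      let s ← eNPHMCstep (mc.getD i ([], [])) w ep L
      pure (mc ++ [s]))
    [((q₀, List.replicate q₀.length 0) : State)]
  pure (mc.map fun s => supported s.1 w)

end

/-! ### Relational semantics -/

/-! Both programs make the same draws in the same order, and the proof matches them as relations
between initial and final weight and trace; failure and divergence both mean "no result". The
mathematical core is `grad_potential_succ`. If `w_{≤n}(q) > 0`, some prefix of `q` has positive
weight, so by tree representability `q ++ [x]` has weight zero and `w_{≤n+1}(q ++ [x]) = w_{≤n}(q)`.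
Over the domain of `U_n`, therefore, `U_{n+1}` is `U_n` composed with dropping the last coordinate,
and its gradient there is that of `U_n` with a zero appended. An added coordinate feels no force:
starting from `x₀, y₀` it is at `x₀ + t * y₀` at time `t`, and the others move as before
(`leapfrog_succ_dim`). So extending the current state in mid-trajectory, as NPHMC does, gives the
same state as restarting from the extended initial state, as eNPHMC does. `sem_forRange_npStep`
turns this into an equality of programs by induction on the remaining steps, comparing `extend` with
`search` by the loop principle `whileLoop_bind_eq`. For the chains it remains to see that the
momentum flip does not affect acceptance and that taking supported prefixes late is harmless. -/

/-- The big-step semantics of a program: a relation between an initial weight and trace, a result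
value, and a final weight and trace. -/
def Sem (α : Type) : Type := ℝ≥0 → Trace → α → ℝ≥0 → Trace → Prop

namespace Sem

@[ext] theorem ext {α : Type} {R S : Sem α} (h : ∀ c t a c' t', R c t a c' t' ↔ S c t a c' t') :
    R = S := by
  funext c t a c' t'
  exact propext (h c t a c' t')

def pure {α : Type} (a : α) : Sem α := fun c t a' c' t' => a' = a ∧ c' = c ∧ t' = t

def bind {α β : Type} (R : Sem α) (S : α → Sem β) : Sem β := fun c t b c' t' =>
  ∃ a c₁ t₁, R c t a c₁ t₁ ∧ S a c₁ t₁ b c' t'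

def fail {α : Type} : Sem α := fun _ _ _ _ _ => False

@[simp] theorem pure_bind {α β : Type} (a : α) (S : α → Sem β) : bind (pure a) S = S a := by
  ext c t b c' t'
  constructor
  · rintro ⟨_, _, _, ⟨rfl, rfl, rfl⟩, h⟩
    exact h
  · exact fun h => ⟨_, _, _, ⟨rfl, rfl, rfl⟩, h⟩

@[simp] theorem fail_bind {α β : Type} (S : α → Sem β) : bind fail S = fail := by
  ext c t b c' t'
  constructor
  · rintro ⟨_, _, _, h, _⟩
    exact h
  · exact fun h => h.elim

@[simp] theorem bind_assoc {α β γ : Type} (R : Sem α) (S : α → Sem β) (T : β → Sem γ) :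
    bind (bind R S) T = bind R fun a => bind (S a) T := by
  ext c t b c' t'
  constructor
  · rintro ⟨b, c₂, t₂, ⟨a, c₁, t₁, hR, hS⟩, hT⟩
    exact ⟨a, c₁, t₁, hR, b, c₂, t₂, hS, hT⟩
  · rintro ⟨a, c₁, t₁, hR, b, c₂, t₂, hS, hT⟩
    exact ⟨b, c₂, t₂, ⟨a, c₁, t₁, hR, hS⟩, hT⟩

@[simp] theorem bind_pure {α : Type} (R : Sem α) : bind R pure = R := by
  ext c t b c' t'
  constructor
  · rintro ⟨_, _, _, h, rfl, rfl, rfl⟩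
    exact h
  · exact fun h => ⟨_, _, _, h, rfl, rfl, rfl⟩

theorem bind_congr_of_mem {α β : Type} {R : Sem α} {S T : α → Sem β}
    (h : ∀ c t a c' t', R c t a c' t' → S a = T a) : bind R S = bind R T := by
  ext c t b c' t'
  constructor
  · rintro ⟨a, c₁, t₁, hR, hS⟩
    exact ⟨a, c₁, t₁, hR, h _ _ _ _ _ hR ▸ hS⟩
  · rintro ⟨a, c₁, t₁, hR, hT⟩
    exact ⟨a, c₁, t₁, hR, h _ _ _ _ _ hR ▸ hT⟩

end Sem

/-! ### From small-step reduction to big-step relations -/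

namespace Prog

/-- Big-step semantics derived from small-step reduction. -/
def sem {α : Type} (m : Prog α) : Sem α := fun c t a c' t' =>
  Relation.ReflTransGen Step (.run m c t) (.run (.ret a) c' t')

/-- Determinism is not needed: the predicates fed to `choose` are equal, so the chosen values and
weights are too. -/
theorem equivalent_of_sem_eq {α : Type} {m m' : Prog α} (h : m.sem = m'.sem) :
    Equivalent m m' := by
  have key : Evaluates m = Evaluates m' := by
    funext v wt t
    exact congrFun (congrFun (congrFun (congrFun (congrFun h 1) []) v) wt) t
  constructor
  · unfold valueFn
    rw [key]
  · unfold weightFn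
    rw [key]

theorem not_step_ret {α : Type} {a : α} {c : ℝ≥0} {t : Trace} {C : Config α} :
    ¬ Step (.run (.ret a) c t) C := by
  intro h
  cases h

theorem not_step_fail {α : Type} {C : Config α} : ¬ Step .fail C := by
  intro h
  cases h

theorem eq_of_reduces_fail {α : Type} {C : Config α}
    (h : Relation.ReflTransGen Step .fail C) : C = .fail := by
  rcases Relation.ReflTransGen.cases_head h with h | ⟨_, h, _⟩
  · exact h.symm
  · exact (not_step_fail h).elim

theorem not_reduces_fail {α : Type} {m : Prog α} {c : ℝ≥0} {t : Trace} :
    ¬ Relation.ReflTransGen Step .fail (.run m c t) := fun h => by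
  cases eq_of_reduces_fail h

@[simp] theorem sem_ret {α : Type} (a : α) : (ret a).sem = Sem.pure a := by
  ext c t b c' t'
  constructor
  · intro h
    rcases Relation.ReflTransGen.cases_head h with h | ⟨_, h, _⟩
    · cases h
      exact ⟨rfl, rfl, rfl⟩
    · exact (not_step_ret h).elim
  · rintro ⟨rfl, rfl, rfl⟩
    exact .refl

@[simp] theorem sem_pure {α : Type} (a : α) : (Pure.pure a : Prog α).sem = Sem.pure a :=
  sem_ret a

theorem sem_fail {α : Type} : (fail : Prog α).sem = Sem.fail := by
  ext c t b c' t'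
  constructor
  · intro h
    rcases Relation.ReflTransGen.cases_head h with h | ⟨C, h, h'⟩
    · cases h
    · cases h
      exact not_reduces_fail h'
  · exact fun h => h.elim

theorem reduces_bind {α β : Type} {m m' : Prog α} (k : α → Prog β) {c c' : ℝ≥0} {t t' : Trace}
    (h : Relation.ReflTransGen Step (.run m c t) (.run m' c' t')) :
    Relation.ReflTransGen Step (.run (.bind m k) c t) (.run (.bind m' k) c' t') := by
  generalize hC : Config.run m c t = C at h
  induction h using Relation.ReflTransGen.head_induction_on generalizing m c t with
  | refl =>
    cases hC
    exact .refl
  | @head C D h₁ h₂ ih =>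
    subst hC
    cases D with
    | run m₁ c₁ t₁ => exact .head (.bind_run k h₁) (ih rfl)
    | fail => exact (not_reduces_fail h₂).elim

/-- Reduction in exactly `n` steps. -/
def ReducesIn {α : Type} : ℕ → Config α → Config α → Prop
  | 0, C, D => C = D
  | n + 1, C, D => ∃ E, Step C E ∧ ReducesIn n E D

theorem ReducesIn.reduces {α : Type} {n : ℕ} {C D : Config α} (h : ReducesIn n C D) :
    Relation.ReflTransGen Step C D := by
  induction n generalizing C with
  | zero => cases h; exact .refl
  | succ n ih =>
    obtain ⟨E, hE, h⟩ := h
    exact .head hE (ih h)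

theorem exists_reducesIn {α : Type} {C D : Config α} (h : Relation.ReflTransGen Step C D) :
    ∃ n, ReducesIn n C D := by
  induction h using Relation.ReflTransGen.head_induction_on with
  | refl => exact ⟨0, rfl⟩
  | head h₁ _ ih =>
    obtain ⟨n, hn⟩ := ih
    exact ⟨n + 1, _, h₁, hn⟩

/-- The strict bound `n' < n` is the decreasing measure for loops, whose unfolding contains the loop
itself. -/
theorem exists_of_reducesIn_bind {α β : Type} {n : ℕ} {m : Prog α} {k : α → Prog β} {c c' : ℝ≥0}
    {t t' : Trace} {b : β} (h : ReducesIn n (.run (.bind m k) c t) (.run (.ret b) c' t')) :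
    ∃ a c₁ t₁, ∃ n' < n, m.sem c t a c₁ t₁ ∧
      ReducesIn n' (.run (k a) c₁ t₁) (.run (.ret b) c' t') := by
  induction n generalizing m c t with
  | zero => cases h
  | succ n ih =>
    obtain ⟨D, h₁, h₂⟩ := h
    cases h₁ with
    | bind_ret a => exact ⟨a, c, t, n, n.lt_succ_self, .refl, h₂⟩
    | bind_run _ h =>
      obtain ⟨a, c₁, t₁, n', hn, hm, hk⟩ := ih h₂
      exact ⟨a, c₁, t₁, n', hn.trans n.lt_succ_self, .head h hm, hk⟩
    | bind_fail => exact (not_reduces_fail h₂.reduces).elim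

@[simp] theorem sem_bind {α β : Type} (m : Prog α) (k : α → Prog β) :
    (bind m k).sem = m.sem.bind fun a => (k a).sem := by
  ext c t b c' t'
  constructor
  · intro h
    obtain ⟨n, hn⟩ := exists_reducesIn h
    obtain ⟨a, c₁, t₁, n', -, hm, hk⟩ := exists_of_reducesIn_bind hn
    exact ⟨a, c₁, t₁, hm, hk.reduces⟩
  · rintro ⟨a, c₁, t₁, hm, hk⟩
    exact (reduces_bind k hm).trans (.head (.bind_ret a k c₁ t₁) hk)

@[simp] theorem sem_bind' {α β : Type} (m : Prog α) (k : α → Prog β) :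
    (m >>= k).sem = m.sem.bind fun a => (k a).sem :=
  sem_bind m k

theorem sem_whileLoop {σ : Type} (cond : σ → Prog Bool) (body : σ → Prog σ) (s : σ) :
    (whileLoop cond body s).sem = (cond s).sem.bind fun b =>
      if b then (body s).sem.bind fun s' => (whileLoop cond body s').sem else Sem.pure s := by
  have key : (whileLoop cond body s).sem = (Prog.bind (cond s) fun b =>
        if b then .bind (body s) (.whileLoop cond body) else .ret s).sem := by
    ext c t b c' t'
    constructor
    · intro h
      rcases Relation.ReflTransGen.cases_head h with h | ⟨C, h, h'⟩
      · cases h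
      · cases h
        exact h'
    · exact fun h => .head (.whileLoop cond body s c t) h
  rw [key, sem_bind]
  congr 1
  funext b
  cases b <;> simp

/-- The unfoldings of a loop with at most `n` tests of its condition. -/
def whileFuel {σ : Type} (cond : σ → Prog Bool) (body : σ → Prog σ) : ℕ → σ → Sem σ
  | 0, _ => Sem.fail
  | n + 1, s => (cond s).sem.bind fun b =>
      if b then (body s).sem.bind (whileFuel cond body n) else Sem.pure s

theorem exists_whileFuel {σ : Type} {cond : σ → Prog Bool} {body : σ → Prog σ} {s a : σ}
    {c c' : ℝ≥0} {t t' : Trace} (h : (whileLoop cond body s).sem c t a c' t') :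
    ∃ n, whileFuel cond body n s c t a c' t' := by
  obtain ⟨n, hn⟩ := exists_reducesIn h
  clear h
  induction n using Nat.strong_induction_on generalizing s c t with
  | _ n ih =>
  cases n with
  | zero => cases hn
  | succ n =>
    obtain ⟨D, h₁, h₂⟩ := hn
    cases h₁
    obtain ⟨b, c₁, t₁, n₁, hn₁, hc, h₃⟩ := exists_of_reducesIn_bind h₂
    cases b with
    | false =>
      refine ⟨1, false, c₁, t₁, hc, ?_⟩
      have := h₃.reduces
      change (ret s).sem c₁ t₁ a c' t' at this
      rw [sem_ret] at this
      exact this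
    | true =>
      obtain ⟨s', c₂, t₂, n₂, hn₂, hb, h₄⟩ := exists_of_reducesIn_bind h₃
      obtain ⟨N, hN⟩ := ih n₂ (by omega) h₄
      exact ⟨N + 1, true, c₁, t₁, hc, s', c₂, t₂, hb, hN⟩

theorem sem_whileLoop_of_whileFuel {σ : Type} {cond : σ → Prog Bool} {body : σ → Prog σ} {s a : σ}
    {n : ℕ} {c c' : ℝ≥0} {t t' : Trace} (h : whileFuel cond body n s c t a c' t') :
    (whileLoop cond body s).sem c t a c' t' := by
  induction n generalizing s c t with
  | zero => exact h.elim
  | succ n ih =>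
    obtain ⟨b, c₁, t₁, hc, h⟩ := h
    rw [sem_whileLoop]
    refine ⟨b, c₁, t₁, hc, ?_⟩
    cases b with
    | false => exact h
    | true =>
      obtain ⟨s', c₂, t₂, hb, h⟩ := h
      exact ⟨s', c₂, t₂, hb, ih h⟩

/-- Two loops run in lock step at `s` and `s'`: both conditions hold, and both bodies make the same
draws and move on to related states. -/
def LockStep {σ τ : Type} (R : σ → τ → Prop) (cond : σ → Prog Bool) (body : σ → Prog σ)
    (cond' : τ → Prog Bool) (body' : τ → Prog τ) (s : σ) (s' : τ) : Prop :=
  (cond s).sem = Sem.pure true ∧ (cond' s').sem = Sem.pure true ∧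
    ∃ (γ : Type) (m : Sem γ) (f : γ → σ) (f' : γ → τ),
      (body s).sem = m.bind (fun g => Sem.pure (f g)) ∧
      (body' s').sem = m.bind (fun g => Sem.pure (f' g)) ∧ ∀ g, R (f g) (f' g)

/-- The continuations belong to the comparison because the loops may stop at different times: once
one of them stops, only loop plus continuation can agree, which is the first alternative of `H`.
Induction on the fuel of the left loop. -/
theorem whileLoop_bind_le {σ τ β : Type} {R : σ → τ → Prop}
    {cond : σ → Prog Bool} {body : σ → Prog σ} {cond' : τ → Prog Bool} {body' : τ → Prog τ}
    {k : σ → Sem β} {k' : τ → Sem β}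
    (H : ∀ s s', R s s' →
      (whileLoop cond body s).sem.bind k = (whileLoop cond' body' s').sem.bind k' ∨
      LockStep R cond body cond' body' s s')
    {s : σ} {s' : τ} (hR : R s s') {c c' : ℝ≥0} {t t' : Trace} {b : β}
    (h : (whileLoop cond body s).sem.bind k c t b c' t') :
    (whileLoop cond' body' s').sem.bind k' c t b c' t' := by
  obtain ⟨a, c₁, t₁, h, hk⟩ := h
  obtain ⟨n, hn⟩ := exists_whileFuel h
  clear h
  induction n generalizing s s' c t with
  | zero => exact hn.elim
  | succ n ih =>
    rcases H s s' hR with heq | ⟨hc, hc', γ, m, f, f', hb, hb', hff⟩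
    · rw [← heq]
      exact ⟨a, c₁, t₁, sem_whileLoop_of_whileFuel hn, hk⟩
    · rw [whileFuel, hc, Sem.pure_bind, if_pos rfl, hb, Sem.bind_assoc] at hn
      simp only [Sem.pure_bind] at hn
      obtain ⟨g, c₂, t₂, hm, hn⟩ := hn
      rw [sem_whileLoop, hc', Sem.pure_bind, if_pos rfl, hb', Sem.bind_assoc, Sem.bind_assoc]
      simp only [Sem.pure_bind]
      exact ⟨g, c₂, t₂, hm, ih (hff g) hn⟩

theorem whileLoop_bind_eq {σ τ β : Type} {R : σ → τ → Prop}
    {cond : σ → Prog Bool} {body : σ → Prog σ} {cond' : τ → Prog Bool} {body' : τ → Prog τ}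
    {k : σ → Sem β} {k' : τ → Sem β}
    (H : ∀ s s', R s s' →
      (whileLoop cond body s).sem.bind k = (whileLoop cond' body' s').sem.bind k' ∨
      LockStep R cond body cond' body' s s')
    {s : σ} {s' : τ} (hR : R s s') :
    (whileLoop cond body s).sem.bind k = (whileLoop cond' body' s').sem.bind k' := by
  ext c t b c' t'
  refine ⟨whileLoop_bind_le H hR, whileLoop_bind_le (R := fun x y => R y x) ?_ hR⟩
  intro x y hxy
  rcases H y x hxy with h | ⟨hc, hc', γ, m, f, f', hb, hb', hff⟩
  · exact .inl h.symm
  · exact .inr ⟨hc', hc, γ, m, f', f, hb', hb, hff⟩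

end Prog

/-! ### Semantics of bounded loops and helper programs -/

theorem sem_forRange_zero {σ : Type} (body : ℕ → σ → Prog σ) (s : σ) :
    (forRange 0 body s).sem = Sem.pure s := by
  rw [forRange, Prog.sem_pure]

theorem sem_forRange_succ {σ : Type} (n : ℕ) (body : ℕ → σ → Prog σ) (s : σ) :
    (forRange (n + 1) body s).sem = (forRange n body s).sem.bind fun s' => (body n s').sem := by
  rw [forRange, Prog.sem_bind']

/-- `forRange` recurses on its last iteration; the induction over the remaining integrator steps has
to split off the first. -/
theorem sem_forRange_succ' {σ : Type} (n : ℕ) (body : ℕ → σ → Prog σ) (s : σ) :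
    (forRange (n + 1) body s).sem =
      (body 0 s).sem.bind fun s' => (forRange n (fun i => body (i + 1)) s').sem := by
  induction n with
  | zero => simp [sem_forRange_succ, sem_forRange_zero]
  | succ n ih =>
    rw [sem_forRange_succ, ih, Sem.bind_assoc]
    simp only [sem_forRange_succ]

@[simp] theorem sem_orFail_none {α : Type} : (orFail (none : Option α)).sem = Sem.fail :=
  Prog.sem_fail

@[simp] theorem sem_orFail_some {α : Type} (a : α) : (orFail (some a)).sem = Sem.pure a :=
  Prog.sem_pure a

theorem length_of_sem_normals {n : ℕ} {c c' : ℝ≥0} {t t' : Trace} {x : List ℝ}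
    (h : (normals n).sem c t x c' t') : x.length = n := by
  induction n generalizing x c' t' with
  | zero =>
    rw [normals, Prog.sem_pure] at h
    simp [h.1]
  | succ n ih =>
    simp only [normals, Prog.sem_bind', Prog.sem_pure] at h
    obtain ⟨xs, _, _, hxs, y, _, _, -, rfl, -⟩ := h
    simp [ih hxs]

/-! ### Gradients of the potential in increasing dimension -/

theorem trunc_append_singleton {w : Trace → ℝ≥0} (hw : TreeRepresentable w) {q : Trace} (x : ℝ)
    (h : 0 < trunc w q.length q) : trunc w (q.length + 1) (q ++ [x]) = trunc w q.length q := by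
  have hlt : ∀ k ∈ Finset.Icc 1 q.length, (w ((q ++ [x]).take k) : ℝ) = w (q.take k) := by
    intro k hk
    rw [List.take_append_of_le_length (Finset.mem_Icc.mp hk).2]
  have hlast : w (q ++ [x]) = 0 := by
    by_contra hne
    refine h.ne' (Finset.sum_eq_zero fun k hk => ?_)
    rw [← hlt k hk, hw _ (pos_iff_ne_zero.mpr hne) k (by simpa using (Finset.mem_Icc.mp hk).2)]
    rfl
  unfold trunc
  rw [Finset.sum_Icc_succ_top (by omega), Finset.sum_congr rfl hlt,
    List.take_of_length_le (by simp), hlast]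
  simp

theorem restrict_potential {w : Trace → ℝ≥0} {n : ℕ} {x : Fin n → ℝ}
    (h : List.ofFn x ∈ (potential w n).Dom) :
    restrict (potential w n) n x = -Real.log (trunc w n (List.ofFn x)) := by
  unfold restrict
  exact dif_pos h

theorem ofFn_eq_init_append {n : ℕ} (x : Fin (n + 1) → ℝ) :
    List.ofFn x = List.ofFn (Fin.init x) ++ [x (Fin.last n)] := by
  rw [List.ofFn_succ', List.concat_eq_append]
  rfl

theorem mem_dom_potential_succ {w : Trace → ℝ≥0} (hw : TreeRepresentable w) {n : ℕ}
    {x : Fin (n + 1) → ℝ} (h : List.ofFn (Fin.init x) ∈ (potential w n).Dom) :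
    List.ofFn x ∈ (potential w (n + 1)).Dom ∧
      restrict (potential w (n + 1)) (n + 1) x = restrict (potential w n) n (Fin.init x) := by
  have key := trunc_append_singleton hw (q := List.ofFn (Fin.init x)) (x (Fin.last n))
    (by simpa using h.2)
  rw [← ofFn_eq_init_append, List.length_ofFn] at key
  have hdom : List.ofFn x ∈ (potential w (n + 1)).Dom := ⟨by simp, key ▸ h.2⟩
  exact ⟨hdom, by rw [restrict_potential hdom, restrict_potential h, key]⟩

/-- Replaces the index type `Fin q.length` by `Fin n`, so that no casts appear when the dimension
grows. `ofFn_fderiv_eq` does the same for the gradient. -/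
theorem gradDefined_iff (f : Trace →. ℝ) {n : ℕ} {q : Trace} {x : Fin n → ℝ}
    (h : q = List.ofFn x) :
    GradDefined f q ↔ (∀ᶠ y in 𝓝 x, List.ofFn y ∈ f.Dom) ∧ DifferentiableAt ℝ (restrict f n) x := by
  obtain rfl : q.length = n := by simp [h]
  obtain rfl : q.get = x := List.ofFn_injective ((List.ofFn_get q).trans h)
  rfl

theorem ofFn_fderiv_eq (f : Trace →. ℝ) {n : ℕ} {q : Trace} {x : Fin n → ℝ}
    (h : q = List.ofFn x) :
    (List.ofFn fun i => fderiv ℝ (restrict f q.length) q.get (Pi.single i 1)) =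
      List.ofFn fun i => fderiv ℝ (restrict f n) x (Pi.single i 1) := by
  obtain rfl : q.length = n := by simp [h]
  obtain rfl : q.get = x := List.ofFn_injective ((List.ofFn_get q).trans h)
  rfl

theorem length_of_grad_eq_some {f : Trace →. ℝ} {q g : Trace} (h : grad f q = some g) :
    g.length = q.length := by
  unfold grad at h
  split_ifs at h
  cases h
  simp

theorem mem_dom_of_grad_eq_some {f : Trace →. ℝ} {q g : Trace} (h : grad f q = some g) :
    q ∈ f.Dom := by
  unfold grad at h
  split_ifs at h with hd
  simpa using hd.1.self_of_nhds

/-- Dropping the last coordinate, as a continuous linear map. -/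
noncomputable def initCLM (n : ℕ) : (Fin (n + 1) → ℝ) →L[ℝ] (Fin n → ℝ) :=
  ContinuousLinearMap.pi fun i => ContinuousLinearMap.proj i.castSucc

theorem initCLM_apply {n : ℕ} (x : Fin (n + 1) → ℝ) : initCLM n x = Fin.init x := rfl

theorem initCLM_single_castSucc {n : ℕ} (i : Fin n) :
    initCLM n (Pi.single i.castSucc 1) = Pi.single i 1 := by
  ext j
  simp [initCLM, Pi.single_apply]

theorem initCLM_single_last (n : ℕ) : initCLM n (Pi.single (Fin.last n) 1) = 0 := by
  ext j
  simp [initCLM, (Fin.castSucc_lt_last j).ne]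

/-- Where the gradient of `U_n` is defined, the one of `U_{n+1}` is its extension by zero. -/
theorem grad_potential_succ {w : Trace → ℝ≥0} (hw : TreeRepresentable w) {n : ℕ} {q g : Trace}
    (x : ℝ) (h : grad (potential w n) q = some g) :
    grad (potential w (n + 1)) (q ++ [x]) = some (g ++ [0]) := by
  obtain ⟨rfl, -⟩ := mem_dom_of_grad_eq_some h
  obtain ⟨n, v, rfl⟩ : ∃ n, ∃ v : Fin n → ℝ, q = List.ofFn v := ⟨_, q.get, by simp⟩
  rw [List.length_ofFn] at h ⊢
  unfold grad at h
  split_ifs at h with hd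
  rw [gradDefined_iff _ rfl] at hd
  rw [ofFn_fderiv_eq _ rfl] at h
  cases h
  have hq : List.ofFn v ++ [x] = List.ofFn (Fin.snoc v x : Fin (n + 1) → ℝ) := by
    rw [ofFn_eq_init_append]
    simp
  have hinit : initCLM n (Fin.snoc v x : Fin (n + 1) → ℝ) = v := by
    simp [initCLM_apply]
  -- `U_{n+1}` is known to factor through `U_n` only over the domain of `U_n`; that domain being a
  -- neighbourhood of `v`, its preimage is one of the extended point.
  have hev : ∀ᶠ y in 𝓝 (Fin.snoc v x : Fin (n + 1) → ℝ),
      List.ofFn (Fin.init y) ∈ (potential w n).Dom := by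
    have := (initCLM n).continuous.tendsto (Fin.snoc v x : Fin (n + 1) → ℝ)
    rw [hinit] at this
    exact this.eventually hd.1
  have hfd : HasFDerivAt (restrict (potential w (n + 1)) (n + 1))
      ((fderiv ℝ (restrict (potential w n) n) v).comp (initCLM n))
      (Fin.snoc v x : Fin (n + 1) → ℝ) := by
    have h₁ : HasFDerivAt (restrict (potential w n) n) (fderiv ℝ (restrict (potential w n) n) v)
        (initCLM n (Fin.snoc v x : Fin (n + 1) → ℝ)) := by
      rw [hinit]
      exact hd.2.hasFDerivAt
    refine (h₁.comp _ (initCLM n).hasFDerivAt).congr_of_eventuallyEq ?_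
    filter_upwards [hev] with y hy
    exact (mem_dom_potential_succ hw hy).2
  have hdef : GradDefined (potential w (n + 1)) (List.ofFn v ++ [x]) := by
    rw [gradDefined_iff _ hq]
    exact ⟨hev.mono fun y hy => (mem_dom_potential_succ hw hy).1, hfd.differentiableAt⟩
  unfold grad
  rw [if_pos hdef, ofFn_fderiv_eq _ hq, hfd.fderiv, ofFn_eq_init_append]
  congr 3
  · funext i
    simp [Fin.init, initCLM_single_castSucc]
  · simp [initCLM_single_last]

/-! ### The leapfrog integrator as a partial function -/

theorem length_axpy {x y : List ℝ} (c : ℝ) (h : y.length = x.length) :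
    (axpy x c y).length = x.length := by
  simp [axpy, h]

theorem axpy_append_singleton {x y : List ℝ} (c a b : ℝ) (h : y.length = x.length) :
    axpy (x ++ [a]) c (y ++ [b]) = axpy x c y ++ [a + c * b] := by
  simp [axpy, List.zipWith_append h.symm]

/-- A half momentum step followed by a position step. -/
noncomputable def kickDrift (U : Trace →. ℝ) (ep : ℝ) (s : State) : Option State :=
  (grad U s.1).map fun g =>
    let p := axpy s.2 (-(ep / 2)) g
    (axpy s.1 ep p, p)

/-- A half momentum step. -/
noncomputable def kick (U : Trace →. ℝ) (ep : ℝ) (s : State) : Option State :=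
  (grad U s.1).map fun g => (s.1, axpy s.2 (-(ep / 2)) g)

/-- `n` leapfrog steps; undefined if a gradient is. -/
noncomputable def leapfrog (U : Trace →. ℝ) (ep : ℝ) : ℕ → State → Option State
  | 0, s => some s
  | n + 1, s => (leapfrog U ep n s).bind fun s' => (kickDrift U ep s').bind (kick U ep)

theorem leapfrog_succ' (U : Trace →. ℝ) (ep : ℝ) (n : ℕ) (s : State) :
    leapfrog U ep (n + 1) s = ((kickDrift U ep s).bind (kick U ep)).bind (leapfrog U ep n) := by
  induction n with
  | zero => simp [leapfrog]
  | succ n ih =>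
    rw [leapfrog, ih, Option.bind_assoc]
    rfl

theorem kickDrift_succ {w : Trace → ℝ≥0} (hw : TreeRepresentable w) {n : ℕ} {ep : ℝ} {s s' : State}
    (x y : ℝ) (hp : s.2.length = s.1.length) (h : kickDrift (potential w n) ep s = some s') :
    s'.1.length = s.1.length ∧ s'.2.length = s'.1.length ∧
      kickDrift (potential w (n + 1)) ep (s.1 ++ [x], s.2 ++ [y]) =
        some (s'.1 ++ [x + ep * y], s'.2 ++ [y]) := by
  obtain ⟨g, hg, rfl⟩ := Option.map_eq_some_iff.mp h
  have hlen := length_of_grad_eq_some hg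
  have h₁ : (axpy s.2 (-(ep / 2)) g).length = s.1.length := by
    rw [length_axpy _ (by omega), hp]
  refine ⟨length_axpy _ h₁, h₁.trans (length_axpy _ h₁).symm, ?_⟩
  unfold kickDrift
  rw [grad_potential_succ hw x hg, Option.map_some]
  dsimp only
  rw [axpy_append_singleton _ _ _ (by omega), mul_zero, add_zero, axpy_append_singleton _ _ _ h₁]

theorem kick_succ {w : Trace → ℝ≥0} (hw : TreeRepresentable w) {n : ℕ} {ep : ℝ} {s s' : State}
    (x y : ℝ) (hp : s.2.length = s.1.length) (h : kick (potential w n) ep s = some s') :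
    s'.1.length = s.1.length ∧ s'.2.length = s'.1.length ∧
      kick (potential w (n + 1)) ep (s.1 ++ [x], s.2 ++ [y]) =
        some (s'.1 ++ [x], s'.2 ++ [y]) := by
  obtain ⟨g, hg, rfl⟩ := Option.map_eq_some_iff.mp h
  have hlen := length_of_grad_eq_some hg
  refine ⟨rfl, by dsimp only; rw [length_axpy _ (by omega), hp], ?_⟩
  unfold kick
  rw [grad_potential_succ hw x hg, Option.map_some]
  dsimp only
  rw [axpy_append_singleton _ _ _ (by omega), mul_zero, add_zero]

theorem leapfrog_succ_dim {w : Trace → ℝ≥0} (hw : TreeRepresentable w) {n : ℕ} {ep : ℝ} {i : ℕ}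
    {s s' : State} (x y : ℝ) (hp : s.2.length = s.1.length)
    (h : leapfrog (potential w n) ep i s = some s') :
    s'.1.length = s.1.length ∧ s'.2.length = s'.1.length ∧
      leapfrog (potential w (n + 1)) ep i (s.1 ++ [x], s.2 ++ [y]) =
        some (s'.1 ++ [x + i * ep * y], s'.2 ++ [y]) := by
  induction i generalizing s' with
  | zero =>
    cases h
    exact ⟨rfl, hp, by simp [leapfrog]⟩
  | succ i ih =>
    obtain ⟨s₁, h₁, h⟩ := Option.bind_eq_some_iff.mp h
    obtain ⟨s₂, h₂, h₃⟩ := Option.bind_eq_some_iff.mp h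
    obtain ⟨l₁, m₁, e₁⟩ := ih h₁
    obtain ⟨l₂, m₂, e₂⟩ := kickDrift_succ hw (x + i * ep * y) y m₁ h₂
    obtain ⟨l₃, m₃, e₃⟩ := kick_succ hw (x + i * ep * y + ep * y) y m₂ h₃
    refine ⟨by omega, m₃, ?_⟩
    rw [leapfrog, e₁, Option.bind_some, e₂, Option.bind_some, e₃]
    congr 4
    push_cast
    ring

/-! ### The integrators as semantic objects -/

theorem sem_halfKick (U : Trace →. ℝ) (ep : ℝ) (q p : List ℝ) :
    (halfKick U ep q p).sem =
      (orFail (grad U q)).sem.bind fun g => Sem.pure (axpy p (-(ep / 2)) g) := by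
  simp [halfKick]

theorem sem_orFail_map {α β γ : Type} (o : Option α) (f : α → β) (S : β → Sem γ) :
    (orFail (o.map f)).sem.bind S = (orFail o).sem.bind fun a => S (f a) := by
  cases o <;> simp

theorem sem_orFail_bind {α β γ : Type} (o : Option α) (f : α → Option β) (S : β → Sem γ) :
    (orFail (o.bind f)).sem.bind S =
      (orFail o).sem.bind fun a => (orFail (f a)).sem.bind S := by
  cases o <;> simp

open scoped Classical in
theorem sem_validstate_succ (s : State) (U : Trace →. ℝ) (ep : ℝ) (n : ℕ) :
    (validstate s U ep (n + 1)).sem = (orFail (kickDrift U ep s)).sem.bind fun s₁ =>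
      if s₁.1 ∉ U.Dom then Sem.pure false
      else (orFail (kick U ep s₁)).sem.bind fun s₂ => (validstate s₂ U ep n).sem := by
  simp only [validstate, Prog.sem_bind', sem_halfKick, Sem.bind_assoc, Sem.pure_bind, kickDrift,
    kick, sem_orFail_map]
  congr 1
  funext g
  split_ifs
  · simp [sem_halfKick]
  · simp

/-- `leapfrog` contains no domain test, but the second kick of each step needs a gradient at the new
position, which forces that position into the domain. So the first `i` tests pass. -/
theorem sem_validstate_add {U : Trace →. ℝ} {ep : ℝ} {i : ℕ} {s s' : State}
    (h : leapfrog U ep i s = some s') (k : ℕ) :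
    (validstate s U ep (i + k)).sem = (validstate s' U ep k).sem := by
  induction i generalizing s with
  | zero =>
    cases h
    rw [Nat.zero_add]
  | succ i ih =>
    rw [leapfrog_succ'] at h
    obtain ⟨s₂, h₂, h⟩ := Option.bind_eq_some_iff.mp h
    obtain ⟨s₁, h₁, h₂⟩ := Option.bind_eq_some_iff.mp h₂
    obtain ⟨g, hg, -⟩ := Option.map_eq_some_iff.mp h₂
    rw [Nat.succ_add, sem_validstate_succ, h₁, sem_orFail_some, Sem.pure_bind,
      if_neg (not_not.mpr (mem_dom_of_grad_eq_some hg)), h₂, sem_orFail_some, Sem.pure_bind, ih h]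

theorem sem_HMCint (s₀ : State) (U : Trace →. ℝ) (ep : ℝ) (n : ℕ) :
    (HMCint s₀ U ep n).sem = (orFail (leapfrog U ep n s₀)).sem.bind fun s =>
      Sem.pure (s.1, s.2.map fun a => -a) := by
  unfold HMCint
  rw [Prog.sem_bind']
  simp only [Prog.sem_pure]
  congr 1
  induction n with
  | zero => simp [sem_forRange_zero, leapfrog]
  | succ n ih =>
    -- The trivial continuations bring both sides into the form to which `sem_orFail_bind` applies.
    rw [sem_forRange_succ, ih, leapfrog, ← Sem.bind_pure (orFail _).sem,
      ← Sem.bind_pure (orFail (Option.bind _ _)).sem]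
    simp only [sem_orFail_bind, kickDrift, kick, sem_orFail_map, Prog.sem_bind', sem_halfKick,
      Sem.bind_assoc, Sem.pure_bind, Prog.sem_pure]

/-- The loop body of `NPint`. -/
noncomputable def npStep (U : ℕ → Trace →. ℝ) (ep : ℝ) (i : ℕ) (s : State × State) :
    Prog (State × State) := do
  let ((q, p), (q₀, p₀)) := s
  let p ← halfKick (U q₀.length) ep q p
  let q := axpy q ep p
  let ((q, p), (q₀, p₀)) ← extend ((q, p), (q₀, p₀)) (((i : ℝ) + 1) * ep) U
  let p ← halfKick (U q₀.length) ep q p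
  pure ((q, p), (q₀, p₀))

theorem sem_npStep (U : ℕ → Trace →. ℝ) (ep : ℝ) (i : ℕ) (s : State × State) :
    (npStep U ep i s).sem = (orFail (kickDrift (U s.2.1.length) ep s.1)).sem.bind fun s₁ =>
      (extend (s₁, s.2) (((i : ℝ) + 1) * ep) U).sem.bind fun s₂ =>
        (orFail (kick (U s₂.2.1.length) ep s₂.1)).sem.bind fun s₃ => Sem.pure (s₃, s₂.2) := by
  simp only [npStep, Prog.sem_bind', sem_halfKick, Sem.bind_assoc, Sem.pure_bind, kickDrift,
    kick, sem_orFail_map, Prog.sem_pure]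

/-- Two independent draws from the standard normal distribution. -/
def Sem.normalPair : Sem (ℝ × ℝ) :=
  Prog.normal.sem.bind fun x => Prog.normal.sem.bind fun y => Sem.pure (x, y)

/-- The result of `search`, together with the endpoint of `n` leapfrog steps from it. -/
noncomputable def searchLeapfrog (U : ℕ → Trace →. ℝ) (ep : ℝ) (n : ℕ) (s₀ : State) :
    Sem (State × State) :=
  (search s₀ U ep n).sem.bind fun s₁ =>
    (orFail (leapfrog (U s₁.1.length) ep n s₁)).sem.bind fun s => Sem.pure (s, s₁)

theorem searchLeapfrog_of_valid {U : ℕ → Trace →. ℝ} {ep : ℝ} {n : ℕ} {s₀ : State}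
    (h : (validstate s₀ (U s₀.1.length) ep n).sem = Sem.pure true) :
    searchLeapfrog U ep n s₀ =
      (orFail (leapfrog (U s₀.1.length) ep n s₀)).sem.bind fun s => Sem.pure (s, s₀) := by
  unfold searchLeapfrog search
  rw [Prog.sem_whileLoop, Prog.sem_bind', h]
  simp

theorem searchLeapfrog_of_fail {U : ℕ → Trace →. ℝ} {ep : ℝ} {n : ℕ} {s₀ : State}
    (h : (validstate s₀ (U s₀.1.length) ep n).sem = Sem.fail) :
    searchLeapfrog U ep n s₀ = Sem.fail := by
  unfold searchLeapfrog search
  rw [Prog.sem_whileLoop, Prog.sem_bind', h]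
  simp

/-- `(st, s₀)` are related if `st.1` is reached from `st.2 = s₀` by `i` leapfrog steps followed by
a half momentum step and a position step, in the dimension of `s₀`. -/
def MidStep (w : Trace → ℝ≥0) (ep : ℝ) (i : ℕ) (st : State × State) (s₀ : State) : Prop :=
  st.2 = s₀ ∧ s₀.2.length = s₀.1.length ∧ ∃ s,
    leapfrog (potential w s₀.1.length) ep i s₀ = some s ∧
    kickDrift (potential w s₀.1.length) ep s = some st.1

theorem MidStep.length_eq {w : Trace → ℝ≥0} {ep : ℝ} {i : ℕ} (hw : TreeRepresentable w)
    {st : State × State} {s₀ : State} (h : MidStep w ep i st s₀) :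
    st.1.1.length = s₀.1.length := by
  obtain ⟨-, hlen, s, h₁, h₂⟩ := h
  obtain ⟨l₁, m₁, -⟩ := leapfrog_succ_dim hw 0 0 hlen h₁
  obtain ⟨l₂, -, -⟩ := kickDrift_succ hw 0 0 m₁ h₂
  omega

/-- The new coordinate drifts freely through `i + 1` position steps, which is the elapsed time used
by `extend`. This makes `MidStep` invariant under one round of both loops. -/
theorem MidStep.append {w : Trace → ℝ≥0} (hw : TreeRepresentable w) {ep : ℝ} {i : ℕ}
    {st : State × State} {s₀ : State} (h : MidStep w ep i st s₀) (x y : ℝ) :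
    MidStep w ep i ((st.1.1 ++ [x + ((i : ℝ) + 1) * ep * y], st.1.2 ++ [y]),
      (st.2.1 ++ [x], st.2.2 ++ [y])) (s₀.1 ++ [x], s₀.2 ++ [y]) := by
  obtain ⟨rfl, hlen, s, h₁, h₂⟩ := h
  obtain ⟨l₁, m₁, e₁⟩ := leapfrog_succ_dim hw x y hlen h₁
  obtain ⟨l₂, m₂, e₂⟩ := kickDrift_succ hw (x + i * ep * y) y m₁ h₂
  refine ⟨rfl, by simp [hlen], _, by rw [List.length_append]; exact e₁, ?_⟩
  rw [List.length_append]
  refine e₂.trans ?_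
  congr 4
  ring

/-- Running `NPint` from the state reached after `i` steps amounts to searching for a state that is
valid for all steps and integrating from there. -/
theorem sem_forRange_npStep {w : Trace → ℝ≥0} (hw : TreeRepresentable w) (ep : ℝ) (k : ℕ) {i : ℕ}
    {s s₀ : State} (hlen : s₀.2.length = s₀.1.length)
    (h : leapfrog (potential w s₀.1.length) ep i s₀ = some s) :
    (forRange k (fun j => npStep (potential w) ep (i + j)) (s, s₀)).sem =
      searchLeapfrog (potential w) ep (i + k) s₀ := by
  classical
  induction k generalizing i s s₀ with
  | zero =>
    have hv := sem_validstate_add h 0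
    rw [searchLeapfrog_of_valid (hv.trans (by simp [validstate])), sem_forRange_zero, Nat.add_zero,
      h, sem_orFail_some, Sem.pure_bind]
  | succ k ih =>
    rw [sem_forRange_succ', sem_npStep, Nat.add_zero]
    rcases hs₁ : kickDrift (potential w s₀.1.length) ep s with _ | s₁
    -- The validity test replays the same trajectory and meets the same undefined gradient, so both
    -- sides fail.
    · rw [searchLeapfrog_of_fail]
      · simp
      · rw [sem_validstate_add h, sem_validstate_succ, hs₁]
        simp
    rw [sem_orFail_some, Sem.pure_bind, Sem.bind_assoc]
    have hmid : MidStep w ep i (s₁, s₀) s₀ := ⟨rfl, hlen, s, h, hs₁⟩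
    unfold searchLeapfrog search extend
    refine Prog.whileLoop_bind_eq (R := MidStep w ep i) ?_ hmid
    clear hmid hs₁ h hlen s₁ s s₀
    rintro ⟨s₁, s₀⟩ s₀' hR
    obtain rfl : s₀ = s₀' := hR.1
    have hl : s₁.1.length = s₀.1.length := hR.length_eq hw
    obtain ⟨-, hlen, s, h, hs₁⟩ := id hR
    have hv := sem_validstate_add h (k + 1)
    rw [sem_validstate_succ, hs₁, sem_orFail_some, Sem.pure_bind] at hv
    by_cases hd : s₁.1 ∈ (potential w s₀.1.length).Dom
    -- `extend` stops here, but `search` may still reject the state at a later step; the induction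
    -- hypothesis identifies the remaining integrator steps with the whole search.
    · left
      rw [if_neg (not_not.mpr hd)] at hv
      change _ = searchLeapfrog (potential w) ep (i + (k + 1)) s₀
      rw [Prog.sem_whileLoop]
      simp only [hl, hd, not_true_eq_false, decide_false, Prog.sem_pure, Sem.pure_bind,
        Bool.false_eq_true, if_false]
      rcases hs₂ : kick (potential w s₀.1.length) ep s₁ with _ | s₂
      · rw [searchLeapfrog_of_fail]
        · simp
        · rw [hv, hs₂]
          simp
      · have hnext : leapfrog (potential w s₀.1.length) ep (i + 1) s₀ = some s₂ := by
          rw [leapfrog, h, Option.bind_some, hs₁, Option.bind_some, hs₂]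
        have := ih hlen hnext
        rw [show i + 1 + k = i + (k + 1) by omega] at this
        rw [← this]
        simp only [sem_orFail_some, Sem.pure_bind, Nat.add_comm, Nat.add_left_comm]
    -- Outside the domain the validity test rejects at this very step, so both loops draw one pair
    -- and extend.
    · right
      rw [if_pos hd] at hv
      refine ⟨?_, ?_, ℝ × ℝ, Sem.normalPair,
        fun g => ((s₁.1 ++ [g.1 + ((i : ℝ) + 1) * ep * g.2], s₁.2 ++ [g.2]),
          (s₀.1 ++ [g.1], s₀.2 ++ [g.2])),
        fun g => (s₀.1 ++ [g.1], s₀.2 ++ [g.2]), ?_, ?_, fun g => hR.append hw g.1 g.2⟩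
      · simp [hl, hd]
      · rw [Prog.sem_bind', hv]
        simp
      · simp [Sem.normalPair]
      · simp [Sem.normalPair]

theorem sem_NPint {w : Trace → ℝ≥0} (hw : TreeRepresentable w) (ep : ℝ) (n : ℕ) {s₀ : State}
    (hlen : s₀.2.length = s₀.1.length) :
    (NPint s₀ (potential w) ep n).sem = searchLeapfrog (potential w) ep n s₀ := by
  have := sem_forRange_npStep hw ep n (i := 0) (s := s₀) hlen rfl
  simp only [Nat.zero_add] at this
  exact this

/-! ### The Markov chains -/

theorem supportedFrom_of_treeRepresentable {w : Trace → ℝ≥0} (hw : TreeRepresentable w) {q : Trace}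
    (hq : 0 < w q) (k : ℕ) : supportedFrom q w k = q := by
  induction hn : q.length - k generalizing k with
  | zero =>
    rw [supportedFrom, if_neg (by omega), List.take_of_length_le (by omega)]
  | succ n ih =>
    rw [supportedFrom, if_pos ⟨hw q hq k (by omega), by omega⟩]
    exact ih (k + 1) (by omega)

theorem supported_nil (w : Trace → ℝ≥0) : supported [] w = [] := by
  rw [supported, supportedFrom]
  simp

theorem pdfN_append_map_neg (q p : List ℝ) :
    pdfN (q ++ p.map fun a => -a) = pdfN (q ++ p) := by
  have : ∀ a : ℝ, ProbabilityTheory.gaussianPDFReal 0 1 (-a) =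
      ProbabilityTheory.gaussianPDFReal 0 1 a := fun a => by
    simp [ProbabilityTheory.gaussianPDFReal]
  simp [pdfN, Function.comp_def, this]

theorem accept_map_neg (q p : List ℝ) (s₀ : State) (w : Trace → ℝ≥0) :
    accept (q, p.map fun a => -a) s₀ w = accept (q, p) s₀ w := by
  unfold accept
  rw [pdfN_append_map_neg]

theorem sem_NPHMCstep {w : Trace → ℝ≥0} (hw : TreeRepresentable w) (s₀ : State) (ep : ℝ) (L : ℕ) :
    (NPHMCstep (supported s₀.1 w) w ep L).sem =
      (eNPHMCstep s₀ w ep L).sem.bind fun s => Sem.pure (supported s.1 w) := by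
  unfold NPHMCstep eNPHMCstep
  simp only [Prog.sem_bind', Sem.bind_assoc]
  -- `sem_NPint` needs momentum and position of equal length, which holds only for actual results of
  -- `normals`.
  refine Sem.bind_congr_of_mem fun c t p₀ c' t' hp₀ => ?_
  rw [sem_NPint hw ep L (length_of_sem_normals hp₀)]
  simp only [searchLeapfrog, sem_HMCint, Sem.bind_assoc, Sem.pure_bind, accept_map_neg]
  congr 1; funext s₁
  congr 1; funext s
  congr 1; funext z
  congr 1; funext a
  split_ifs <;> simp

theorem sem_NPHMC {w : Trace → ℝ≥0} (hw : TreeRepresentable w) {q₀ : Trace} (hq₀ : 0 < w q₀)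
    (ep : ℝ) (L M : ℕ) : (NPHMC q₀ w ep L M).sem = (eNPHMC q₀ w ep L M).sem := by
  unfold NPHMC eNPHMC
  rw [Prog.sem_bind']
  simp only [Prog.sem_pure]
  induction M with
  | zero =>
    -- eNPHMC applies `supported` to the initial trace as well; positivity of `w q₀` makes this the
    -- identity.
    simp [sem_forRange_zero, supported, supportedFrom_of_treeRepresentable hw hq₀]
  | succ M ih =>
    rw [sem_forRange_succ, sem_forRange_succ, ih, Sem.bind_assoc, Sem.bind_assoc]
    congr 1
    funext mc
    -- The default values of the two lookups correspond since `supported [] w = []`, so the length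
    -- of `mc` need not be tracked.
    have hget : (mc.map fun s : State => supported s.1 w).getD M [] =
        supported (mc.getD M ([], [])).1 w := by
      rw [← List.getD_map (f := fun s : State => supported s.1 w)]
      simp only [supported_nil]
    simp only [Sem.pure_bind, Prog.sem_bind', hget, sem_NPHMCstep hw, Sem.bind_assoc, Prog.sem_pure,
      List.map_append, List.map_cons, List.map_nil]

theorem mainTheorem9 (w : Trace → ℝ≥0) (hw : TreeRepresentable w)
    (q₀ : Trace) (hq₀ : 0 < w q₀) (ep : ℝ) (L M : ℕ) :
    Equivalent (NPHMC q₀ w ep L M) (eNPHMC q₀ w ep L M) :=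
  Prog.equivalent_of_sem_eq (sem_NPHMC hw hq₀ ep L M)
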